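/- \textbf{Deforming algebras of continuous functions.} Let $M$ be a compact metric space, let $\mathbb{K}$ be $\mathbb{R}$ or $\mathbb{C}$, and let $C(M)$ be the Banach space of continuous $\mathbb{K}$-valued functions on $M$ (with the supremum norm), with its pointwise product $\cdot$. Let $I\subseteq\mathbb{R}$ be an open interval containing $0$, and let $(\odot_t)_{t\in I}$ be a continuous deformation of $(C(M),\cdot)$ of class $C^1$ in $t$; that is: each $\odot_t$ is an associative $\mathbb{K}$-bilinear product on $C(M)$; $\odot_0$ is the pointwise product; for each $t\in I$ there is a continuous linear map $m_t\colon C(M\times M)\to C(M)$ with $m_t(f\otimes g)=f\odot_t g$ for all $f,g\in C(M)$, where $(f\otimes g)(x,y)=f(x)g(y)$; and $t\mapsto m_t$ is of class $C^1$ on $I$ as a map into the Banach space of continuous linear maps $C(M\times M)\to C(M)$ with the operator norm. Then the deformation is equivalent to the trivial one: there are $\varepsilon>0$ with $(-\varepsilon,\varepsilon)\subseteq I$ and, for each $t\in(-\varepsilon,\varepsilon)$, a bijective linear map $h_t\colon C(M)\to C(M)$, continuous with continuous inverse, such that $h_t(f\cdot g)=h_t(f)\odot_t h_t(g)$ for all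 $f,g\in C(M)$, such that $h_0=\mathrm{Id}$, and such that $t\mapsto h_t$ is of class $C^1$ on $(-\varepsilon,\varepsilon)$ as a map into the Banach space of continuous linear operators on $C(M)$ with the operator norm. -/

import Mathlib

open Set

/-- The elementary tensor `f ⊗ g`, i.e. the function `(x, y) ↦ f x * g y` on `M × M`. -/
def tensorFun {𝕜 M : Type*} [RCLike 𝕜] [TopologicalSpace M] (f g : C(M, 𝕜)) : C(M × M, 𝕜) :=
  f.comp ContinuousMap.fst * g.comp ContinuousMap.snd

/-- A bilinear product `B` on `C(M)` extends to the continuous linear map `T : C(M × M) → C(M)`. -/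
def ExtendsTo {𝕜 M : Type*} [RCLike 𝕜] [TopologicalSpace M] [CompactSpace M]
    (B : C(M, 𝕜) →ₗ[𝕜] C(M, 𝕜) →ₗ[𝕜] C(M, 𝕜)) (T : C(M × M, 𝕜) →L[𝕜] C(M, 𝕜)) : Prop :=
  ∀ f g : C(M, 𝕜), T (tensorFun f g) = B f g

/-- `mul t`, for `t ∈ I`, is a continuous deformation of class `C^k` in `t` of the pointwise product
on `C(M)`: every `mul t` is an associative bilinear product that extends to a continuous linear map
`C(M × M) → C(M)`, these extensions form a `C^k` family in the Banach space of continuous linear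
maps (with the operator norm), and `mul 0` is the pointwise product. Values of `mul` outside `I`
are irrelevant. -/
structure IsContinuousDeformation {𝕜 M : Type*} [RCLike 𝕜] [TopologicalSpace M] [CompactSpace M]
    (k : ℕ∞) (I : Set ℝ) (mul : ℝ → C(M, 𝕜) →ₗ[𝕜] C(M, 𝕜) →ₗ[𝕜] C(M, 𝕜)) : Prop where
  assoc : ∀ t ∈ I, ∀ f g l : C(M, 𝕜), mul t (mul t f g) l = mul t f (mul t g l)
  mul_zero_eq : ∀ f g : C(M, 𝕜), mul 0 f g = f * g
  exists_extension : ∃ T : ℝ → (C(M × M, 𝕜) →L[𝕜] C(M, 𝕜)),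
    (∀ t ∈ I, ExtendsTo (mul t) (T t)) ∧ ContDiffOn ℝ k T I

/-!
Write `A = C(M, 𝕜)`. The deformation is trivialised through its characters: for small `t` every
evaluation `δ_x` deforms to a functional `φ_{t,x}` close to `δ_x` and multiplicative for `⊙_t`, and
the operator `(S_t f) x = φ_{t,x} f` satisfies `S_t (f ⊙_t g) = S_t f * S_t g` and `S_0 = id`, so
that `h_t = S_t⁻¹` is the required equivalence.

To find `φ_{t,x}`, choose `κ_x ∈ A**`, a weak-* limit of functions peaking at `x`. It plays the role
of the indicator function of `x`, in that `κ_x (η(· g)) = g x * κ_x η` (`exists_isPointMean_eval`).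
If `φ` is multiplicative for a product `⊙`, then applying `κ_x` in the first variable gives
`κ_x (φ(· ⊙ f)) = κ_x φ * φ f`. The derivative of the difference of the two sides with respect to
`φ`, at `φ = δ_x` and the pointwise product, is `-id`; hence the implicit function theorem solves
this equation for every product near the pointwise one. It is only a consequence of
multiplicativity, but for an associative product it implies it: the defect
`c (f, g) = φ (f ⊙ g) - φ f * φ g` satisfies a cocycle identity, and `κ_x` applied to that identity
bounds `‖c‖` by a small multiple of itself (`IsPointMean.map_mul_of_forall_map_comp_flip`). Two
multiplicative functionals near `δ_x` coincide for a similar reason (`IsPointMean.eq_of_map_mul`).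

All points are treated at once by letting the functionals form one operator
`Φ : C(M, 𝕜) → ℓ^∞(M)`, so that the estimates and the regularity in `t` are uniform in `x`. The
uniqueness statement shows that `Φ` has values in the continuous functions: along an ultrafilter
converging to `x`, a weak-* limit of the `φ_{t,y}` is multiplicative and near `δ_x`, hence equal to
`φ_{t,x}` (`continuous_apply_of_map_mul`).

The bilinear products used in the argument are composed from the extensions `C(M × M) → C(M)` and
the bounded bilinear map `(f, g) ↦ f ⊗ g`.
-/

open Filter Topology
open scoped ContDiff ENNReal

universe u v

/-! ### The averaged multiplicativity equation -/

/-- The implicit function theorem for an equation whose partial derivative in the unknown is `-id`;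
the solution is moreover near the base point. -/
theorem ContDiff.exists_implicitFunction_of_neg_id {𝕜 E F : Type*} [RCLike 𝕜]
    [NormedAddCommGroup E] [NormedSpace 𝕜 E] [CompleteSpace E]
    [NormedAddCommGroup F] [NormedSpace 𝕜 F] [CompleteSpace F] {f : E × F → F} {a : E} {b : F}
    (hf : ContDiff 𝕜 1 f)
    (hb : HasFDerivAt (fun y => f (a, y)) (-ContinuousLinearMap.id 𝕜 F) b)
    {ε : ℝ} (hε : 0 < ε) :
    ∃ φ : E → F, φ a = b ∧ ContDiffAt 𝕜 1 φ a ∧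
      ∀ᶠ x in 𝓝 a, ‖x - a‖ + ‖φ x - b‖ < ε ∧ f (x, φ x) = f (a, b) := by
  have hG : ContDiffAt 𝕜 1 f (a, b) := hf.contDiffAt
  have hinv : (fderiv 𝕜 f (a, b) ∘L ContinuousLinearMap.inr 𝕜 E F).IsInvertible := by
    have h1 : HasFDerivAt f (fderiv 𝕜 f (a, b)) (a, b) :=
      (hf.differentiable one_ne_zero _).hasFDerivAt
    have h2 := h1.comp b (hasFDerivAt_prodMk_right a b)
    rw [h2.unique hb]
    exact ⟨ContinuousLinearEquiv.neg 𝕜, rfl⟩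
  have hφ : ContDiffAt 𝕜 1 (hG.implicitFunction one_ne_zero hinv) a :=
    hG.contDiffAt_implicitFunction one_ne_zero hinv
  have h0 : ∀ᶠ x in 𝓝 a, f (x, hG.implicitFunction one_ne_zero hinv x) = f (a, b) :=
    hG.eventually_apply_implicitFunction one_ne_zero hinv
  have hself : hG.implicitFunction one_ne_zero hinv a = b :=
    hG.implicitFunction_apply_self one_ne_zero hinv
  generalize hG.implicitFunction one_ne_zero hinv = φ at hφ h0 hself
  have hcont : ContinuousAt (fun x => ‖x - a‖ + ‖φ x - b‖) a := by
    have := hφ.continuousAt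
    fun_prop
  exact ⟨φ, hself, hφ, (hcont.eventually_lt_const (by simpa [hself] using hε)).and h0⟩

section Defect

-- `A` and `R` share a universe: otherwise the levels `max _ _` of the nested operator spaces do not
-- unify in the search for their norm instances.
variable {𝕜 : Type v} {A R : Type u} [NontriviallyNormedField 𝕜]
  [NormedAddCommGroup A] [NormedSpace 𝕜 A] [NormedAddCommGroup R] [NormedSpace 𝕜 R]

/-- The operator `f ↦ K (Φ (B · f)) - ν (K Φ) (Φ f)`, as a function of the pair `(B, Φ)`. Here `B`
is a product on `A`, `ν` a product on `R`, and `K` is to be thought of as evaluation at an indicator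
function; the expression vanishes if `Φ` is multiplicative from `B` to `ν` and `K` is linear over
`(R, ν)`. -/
noncomputable def meanDefect (ν : R →L[𝕜] R →L[𝕜] R) (K : (A →L[𝕜] R) →L[𝕜] R)
    (p : (A →L[𝕜] A →L[𝕜] A) × (A →L[𝕜] R)) : A →L[𝕜] R :=
  K.comp ((ContinuousLinearMap.compL 𝕜 A A R p.2).comp p.1.flip) - (ν (K p.2)).comp p.2

variable {μ : A →L[𝕜] A →L[𝕜] A} {ν : R →L[𝕜] R →L[𝕜] R} {ι : A →L[𝕜] R}
  {K : (A →L[𝕜] R) →L[𝕜] R}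

theorem meanDefect_apply (B : A →L[𝕜] A →L[𝕜] A) (Φ : A →L[𝕜] R) (f : A) :
    meanDefect ν K (B, Φ) f = K (Φ.comp (B.flip f)) - ν (K Φ) (Φ f) := rfl

theorem contDiff_meanDefect (ν : R →L[𝕜] R →L[𝕜] R) (K : (A →L[𝕜] R) →L[𝕜] R) {n : ℕ∞ω} :
    ContDiff 𝕜 n (meanDefect ν K) := by
  unfold meanDefect
  have h1 : ContDiff 𝕜 n fun p : (A →L[𝕜] A →L[𝕜] A) × (A →L[𝕜] R) => p.1.flip :=
    (ContinuousLinearMap.flipₗᵢ 𝕜 A A A).toContinuousLinearEquiv.contDiff.comp contDiff_fst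
  have h2 : ContDiff 𝕜 n fun p : (A →L[𝕜] A →L[𝕜] A) × (A →L[𝕜] R) =>
      ContinuousLinearMap.compL 𝕜 A A R p.2 := by fun_prop
  have h3 : ContDiff 𝕜 n fun p : (A →L[𝕜] A →L[𝕜] A) × (A →L[𝕜] R) => ν (K p.2) :=
    ν.contDiff.comp (K.contDiff.comp contDiff_snd)
  exact (contDiff_const.clm_comp (h2.clm_comp h1)).sub (h3.clm_comp contDiff_snd)

theorem meanDefect_base (hK : ∀ g Ψ, K (Ψ.comp (μ.flip g)) = ν (K Ψ) (ι g)) (Φ : A →L[𝕜] R) :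
    meanDefect ν K (μ, Φ) = (ν (K Φ)).comp (ι - Φ) := by
  ext f
  simp [meanDefect_apply, hK]

theorem hasFDerivAt_meanDefect_base (hK : ∀ g Ψ, K (Ψ.comp (μ.flip g)) = ν (K Ψ) (ι g))
    (hν : ∀ r, ν (K ι) r = r) :
    HasFDerivAt (fun Φ => meanDefect ν K (μ, Φ)) (-ContinuousLinearMap.id 𝕜 (A →L[𝕜] R)) ι := by
  have h4 : HasFDerivAt (fun Φ : A →L[𝕜] R => ν (K Φ)) (ν.comp K) ι := (ν.comp K).hasFDerivAt
  have h5 : HasFDerivAt (fun Φ : A →L[𝕜] R => ι - Φ)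
      (-ContinuousLinearMap.id 𝕜 (A →L[𝕜] R)) ι := (hasFDerivAt_id ι).const_sub ι
  have h6 := h4.clm_comp h5
  simp only [← meanDefect_base hK] at h6
  refine h6.congr_fderiv ?_
  ext η f
  simp [hν]

variable {X : Type u} [NormedAddCommGroup X] [NormedSpace 𝕜 X]

/-- The bilinear product `(f, g) ↦ T (τ f g)` determined by a bounded bilinear map `τ` and a linear
map `T`, as a bounded linear function of `T`. -/
noncomputable def productOfExtension (τ : A →L[𝕜] A →L[𝕜] X) :
    (X →L[𝕜] A) →L[𝕜] A →L[𝕜] A →L[𝕜] A :=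
  ((ContinuousLinearMap.compL 𝕜 A (A →L[𝕜] X) (A →L[𝕜] A)).flip τ).comp
    (ContinuousLinearMap.compL 𝕜 A X A)

theorem productOfExtension_apply (τ : A →L[𝕜] A →L[𝕜] X) (T : X →L[𝕜] A) (f g : A) :
    productOfExtension τ T f g = T (τ f g) := rfl

theorem contDiff_productOfExtension (τ : A →L[𝕜] A →L[𝕜] X) {n : ℕ∞ω} :
    ContDiff 𝕜 n (productOfExtension τ) :=
  (productOfExtension τ).contDiff

end Defect

/-! ### Multiplicative operators for nearby associative products -/

/-- `K` behaves on operators `A → R` like evaluation at the indicator function of a point. For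
`R = 𝕜` and `ι` the evaluation at `x`, such a `K` is an element of the bidual of `A` that is the
indicator function of `x`; a general `R` allows for a family of points. The bilinear map `μ` is the
product of `A`. -/
structure IsPointMean {𝕜 A R : Type*} [RCLike 𝕜] [NormedAddCommGroup A] [NormedSpace 𝕜 A]
    [NormedCommRing R] [NormedAlgebra 𝕜 R] (μ : A →L[𝕜] A →L[𝕜] A)
    (ι : A →L[𝕜] R) (K : (A →L[𝕜] R) →L[𝕜] R) : Prop where
  norm_apply_le : ∀ Ψ, ‖K Ψ‖ ≤ ‖Ψ‖
  map_mul_comp : ∀ r Ψ, K ((ContinuousLinearMap.mul 𝕜 R r).comp Ψ) = r * K Ψ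
  map_comp_mul : ∀ g Ψ, K (Ψ.comp (μ.flip g)) = ι g * K Ψ
  map_self : K ι = 1

section Abstract

variable {𝕜 A R : Type*} [RCLike 𝕜] [NormedAddCommGroup A] [NormedSpace 𝕜 A]
  [NormedCommRing R] [NormedAlgebra 𝕜 R] {μ : A →L[𝕜] A →L[𝕜] A} {ι : A →L[𝕜] R}
  {K : (A →L[𝕜] R) →L[𝕜] R}

theorem IsPointMean.norm_comp_flip_sub_le (hK : IsPointMean μ ι K) (B : A →L[𝕜] A →L[𝕜] A)
    (Ψ : A →L[𝕜] R) (g : A) :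
    ‖K (Ψ.comp (B.flip g)) - ι g * K Ψ‖ ≤ ‖Ψ‖ * (‖B - μ‖ * ‖g‖) := by
  have h : K (Ψ.comp (B.flip g)) - ι g * K Ψ =
      K (Ψ.comp ((B - μ).flip g)) := by
    rw [← hK.map_comp_mul, ← map_sub, ← ContinuousLinearMap.comp_sub]
    congr 2
  rw [h]
  refine (hK.norm_apply_le _).trans ((ContinuousLinearMap.opNorm_comp_le _ _).trans ?_)
  gcongr
  refine (ContinuousLinearMap.le_opNorm _ _).trans ?_
  rw [ContinuousLinearMap.opNorm_flip]

theorem IsPointMean.norm_map_sub_one_le (hK : IsPointMean μ ι K) (Φ : A →L[𝕜] R) :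
    ‖K Φ - 1‖ ≤ ‖Φ - ι‖ := by
  rw [← hK.map_self, ← map_sub]
  exact hK.norm_apply_le _

/-- For an associative product `B` near `μ` and an operator `Φ` near `ι`, multiplicativity of `Φ`
follows from its special case obtained by averaging the first factor with `K`. -/
theorem IsPointMean.map_mul_of_forall_map_comp_flip (hK : IsPointMean μ ι K)
    {B : A →L[𝕜] A →L[𝕜] A} {Φ : A →L[𝕜] R}
    (hB : ∀ f g l, B (B f g) l = B f (B g l)) (h0 : ∀ d, K (Φ.comp (B.flip d)) = K Φ * Φ d)
    (hsmall : ‖B - μ‖ + ‖Φ - ι‖ < 1) (f g : A) :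
    Φ (B f g) = Φ f * Φ g := by
  set c : A →L[𝕜] A →L[𝕜] R := (ContinuousLinearMap.compL 𝕜 A A R Φ).comp B -
    (ContinuousLinearMap.mul 𝕜 R).bilinearComp Φ Φ with hc
  have hc_apply : ∀ a b, c a b = Φ (B a b) - Φ a * Φ b := fun a b => rfl
  -- The hypothesis on `Φ` says that `K` annihilates the defect `c` in its first variable.
  have hKc : ∀ d, K (c.flip d) = 0 := by
    intro d
    have h1 : c.flip d = Φ.comp (B.flip d) - (ContinuousLinearMap.mul 𝕜 R (Φ d)).comp Φ := by
      ext a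
      simp [hc_apply, mul_comm]
    rw [h1, map_sub, hK.map_mul_comp, h0, mul_comm, sub_self]
  -- This is `K`, in the variable `a`, of the identity
  -- `c (B a b) d - c a (B b d) = Φ a * c b d - c a b * Φ d`, which expresses associativity.
  have hcocycle : ∀ b d, K ((c.flip d).comp (B.flip b)) = c b d * K Φ := by
    intro b d
    have h1 : (c.flip d).comp (B.flip b) = c.flip (B b d) +
        (ContinuousLinearMap.mul 𝕜 R (c b d)).comp Φ -
        (ContinuousLinearMap.mul 𝕜 R (Φ d)).comp (c.flip b) := by
      ext a
      simp only [hc_apply, ContinuousLinearMap.comp_apply, ContinuousLinearMap.flip_apply,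
        sub_apply, add_apply, ContinuousLinearMap.mul_apply', hB]
      ring
    rw [h1, map_sub, map_add, hK.map_mul_comp, hK.map_mul_comp, hKc, hKc]
    ring
  set δ := ‖B - μ‖ + ‖Φ - ι‖ with hδ
  have hbound : ‖c‖ ≤ δ * ‖c‖ := by
    refine ContinuousLinearMap.opNorm_le_bound₂ _ (by positivity) fun b d => ?_
    -- Replacing `B` by `μ` in `hcocycle` makes the left-hand side `ι b * K (c.flip d) = 0`.
    have h1 := hK.norm_comp_flip_sub_le B (c.flip d) b
    rw [hKc, mul_zero, sub_zero, hcocycle] at h1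
    have h2 : c b d = c b d * K Φ - c b d * (K Φ - 1) := by ring
    have h3 : ‖c.flip d‖ ≤ ‖c‖ * ‖d‖ := by
      simpa using c.flip.le_opNorm d
    have h4 : ‖c b d * (K Φ - 1)‖ ≤ ‖c‖ * ‖b‖ * ‖d‖ * ‖Φ - ι‖ :=
      (norm_mul_le _ _).trans (mul_le_mul (c.le_opNorm₂ b d) (hK.norm_map_sub_one_le Φ)
        (norm_nonneg _) (by positivity))
    calc ‖c b d‖ = ‖c b d * K Φ - c b d * (K Φ - 1)‖ := by rw [← h2]
      _ ≤ ‖c b d * K Φ‖ + ‖c b d * (K Φ - 1)‖ := norm_sub_le _ _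
      _ ≤ ‖c‖ * ‖d‖ * (‖B - μ‖ * ‖b‖) +
          ‖c‖ * ‖b‖ * ‖d‖ * ‖Φ - ι‖ :=
        add_le_add (h1.trans (by gcongr)) h4
      _ = δ * ‖c‖ * ‖b‖ * ‖d‖ := by rw [hδ]; ring
  have hc0 : c = 0 := (ContinuousLinearMap.opNorm_zero_iff c).1 (by nlinarith [norm_nonneg c])
  have h5 := hc_apply f g
  rw [hc0] at h5
  exact (sub_eq_zero.1 h5.symm)

/-- Two multiplicative operators near `ι` coincide: their difference satisfies a twisted Leibniz
rule, and `K` applied to that rule bounds it by a small multiple of itself. -/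
theorem IsPointMean.eq_of_map_mul (hK : IsPointMean μ ι K) {B : A →L[𝕜] A →L[𝕜] A}
    {Φ Ψ : A →L[𝕜] R} (hΦ : ∀ f g, Φ (B f g) = Φ f * Φ g) (hΨ : ∀ f g, Ψ (B f g) = Ψ f * Ψ g)
    (hsmall : ‖B - μ‖ + ‖Φ - ι‖ + ‖Ψ - ι‖ < 1) : Φ = Ψ := by
  set η := Ψ - Φ with hη
  set δ := ‖B - μ‖ + ‖Φ - ι‖ + ‖Ψ - ι‖ with hδ
  have hbound : ‖η‖ ≤ δ * ‖η‖ := by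
    refine ContinuousLinearMap.opNorm_le_bound _ (by positivity) fun g => ?_
    have h1 := hK.norm_comp_flip_sub_le B η g
    have h2 : η.comp (B.flip g) = (ContinuousLinearMap.mul 𝕜 R (Ψ g)).comp η +
        (ContinuousLinearMap.mul 𝕜 R (η g)).comp Φ := by
      ext a
      simp only [hη, ContinuousLinearMap.comp_apply, ContinuousLinearMap.flip_apply,
        sub_apply, add_apply, ContinuousLinearMap.mul_apply', hΦ, hΨ]
      ring
    have h3 : η g = (K (η.comp (B.flip g)) - ι g * K η) - (Ψ - ι) g * K η - η g * (K Φ - 1) := by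
      rw [h2, map_add, hK.map_mul_comp, hK.map_mul_comp, sub_apply Ψ ι]
      ring
    have h4 : ‖(Ψ - ι) g * K η‖ ≤ ‖Ψ - ι‖ * ‖g‖ * ‖η‖ :=
      (norm_mul_le _ _).trans (mul_le_mul ((Ψ - ι).le_opNorm g) (hK.norm_apply_le η)
        (norm_nonneg _) (by positivity))
    have h5 : ‖η g * (K Φ - 1)‖ ≤ ‖η‖ * ‖g‖ * ‖Φ - ι‖ :=
      (norm_mul_le _ _).trans (mul_le_mul (η.le_opNorm g) (hK.norm_map_sub_one_le Φ)
        (norm_nonneg _) (by positivity))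
    calc ‖η g‖ ≤ ‖K (η.comp (B.flip g)) - ι g * K η‖ + ‖(Ψ - ι) g * K η‖ +
          ‖η g * (K Φ - 1)‖ := by
          conv_lhs => rw [h3]
          exact (norm_sub_le _ _).trans (add_le_add_left (norm_sub_le _ _) _)
      _ ≤ ‖η‖ * (‖B - μ‖ * ‖g‖) + ‖Ψ - ι‖ * ‖g‖ * ‖η‖ +
          ‖η‖ * ‖g‖ * ‖Φ - ι‖ := by gcongr
      _ = δ * ‖η‖ * ‖g‖ := by rw [hδ]; ring
  have hη0 : η = 0 := (ContinuousLinearMap.opNorm_zero_iff η).1 (by nlinarith [norm_nonneg η])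
  exact (sub_eq_zero.1 hη0).symm

/-- Near `μ`, every associative product `B` has a multiplicative operator `Φ B` near `ι`, with `Φ`
of class `C^1` in `B`. -/
theorem IsPointMean.exists_contDiffAt_map_mul {𝕜 : Type v} {A R : Type u} [RCLike 𝕜]
    [NormedAddCommGroup A] [NormedSpace 𝕜 A] [NormedCommRing R] [NormedAlgebra 𝕜 R]
    {μ : A →L[𝕜] A →L[𝕜] A} {ι : A →L[𝕜] R} {K : (A →L[𝕜] R) →L[𝕜] R}
    [CompleteSpace A] [CompleteSpace R]
    (hK : IsPointMean μ ι K) {ε : ℝ} (hε : 0 < ε) (hε1 : ε ≤ 1) :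
    ∃ Φ : (A →L[𝕜] A →L[𝕜] A) → (A →L[𝕜] R), Φ μ = ι ∧ ContDiffAt 𝕜 1 Φ μ ∧
      ∀ᶠ B in 𝓝 μ, ‖B - μ‖ + ‖Φ B - ι‖ < ε ∧
        ((∀ f g l, B (B f g) l = B f (B g l)) → ∀ f g, Φ B (B f g) = Φ B f * Φ B g) := by
  have hK' : ∀ g Ψ, K (Ψ.comp (μ.flip g)) = ContinuousLinearMap.mul 𝕜 R (K Ψ) (ι g) :=
    fun g Ψ => (hK.map_comp_mul g Ψ).trans (mul_comm _ _)
  obtain ⟨Φ, h1, h2, h3⟩ := ContDiff.exists_implicitFunction_of_neg_id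
    (contDiff_meanDefect (ContinuousLinearMap.mul 𝕜 R) K)
    (hasFDerivAt_meanDefect_base hK' fun r => by simp [hK.map_self]) hε
  refine ⟨Φ, h1, h2, h3.mono fun B hB => ⟨hB.1, fun hassoc f g => ?_⟩⟩
  refine hK.map_mul_of_forall_map_comp_flip hassoc (fun d => ?_)
    (hB.1.trans_le hε1) f g
  have h4 := hB.2
  rw [meanDefect_base hK', sub_self, ContinuousLinearMap.comp_zero] at h4
  exact sub_eq_zero.1 (congrArg (fun T : A →L[𝕜] R => T d) h4)

/-- The version of `IsPointMean.exists_contDiffAt_map_mul` in which the product is parametrised by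
its linear extension `T`. -/
theorem IsPointMean.exists_contDiffAt_map_mul_extension {𝕜 : Type v} {A R X : Type u} [RCLike 𝕜]
    [NormedAddCommGroup A] [NormedSpace 𝕜 A] [NormedAddCommGroup X] [NormedSpace 𝕜 X]
    [NormedCommRing R] [NormedAlgebra 𝕜 R]
    {μ : A →L[𝕜] A →L[𝕜] A} {ι : A →L[𝕜] R} {K : (A →L[𝕜] R) →L[𝕜] R}
    [CompleteSpace A] [CompleteSpace R] (hK : IsPointMean μ ι K) {ε : ℝ} (hε : 0 < ε) (hε1 : ε ≤ 1)
    {τ : A →L[𝕜] A →L[𝕜] X} {T₀ : X →L[𝕜] A} (hT₀ : productOfExtension τ T₀ = μ) :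
    ∃ Φ : (X →L[𝕜] A) → (A →L[𝕜] R), Φ T₀ = ι ∧ ContDiffAt 𝕜 1 Φ T₀ ∧
      ∀ᶠ T in 𝓝 T₀, ‖productOfExtension τ T - μ‖ + ‖Φ T - ι‖ < ε ∧
        ((∀ f g l, T (τ (T (τ f g)) l) = T (τ f (T (τ g l)))) →
          ∀ f g, Φ T (T (τ f g)) = Φ T f * Φ T g) := by
  obtain ⟨Φ, h1, h2, h3⟩ := hK.exists_contDiffAt_map_mul hε hε1
  rw [← hT₀] at h2 h3
  refine ⟨fun T => Φ (productOfExtension τ T), (congrArg Φ hT₀).trans h1,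
    h2.comp T₀ (contDiff_productOfExtension τ).contDiffAt, ?_⟩
  have h4 := (productOfExtension τ).continuous.continuousAt (x := T₀) |>.eventually h3
  simp only [hT₀, productOfExtension_apply] at h4
  exact h4

end Abstract

/-! ### Weak-* limits along ultrafilters -/

/-- Banach–Alaoglu: a bounded family of functionals has a pointwise limit along any ultrafilter. -/
theorem Ultrafilter.exists_tendsto_apply_of_norm_le {𝕜 E α : Type*} [RCLike 𝕜]
    [NormedAddCommGroup E] [NormedSpace 𝕜 E] (U : Ultrafilter α) {φ : α → (E →L[𝕜] 𝕜)} {C : ℝ}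
    (hφ : ∀ a, ‖φ a‖ ≤ C) :
    ∃ ψ : E →L[𝕜] 𝕜, ‖ψ‖ ≤ C ∧ ∀ e, Tendsto (fun a => φ a e) U (𝓝 (ψ e)) := by
  have hcomp := WeakDual.isCompact_closedBall (𝕜 := 𝕜) (0 : StrongDual 𝕜 E) C
  obtain ⟨ψ, hψ, hlim⟩ := hcomp.ultrafilter_le_nhds
    (U.map fun a => StrongDual.toWeakDual (φ a)) (by
      rw [le_principal_iff]
      refine Filter.Eventually.of_forall (f := (U : Filter α)) fun a => ?_
      simpa using hφ a)
  refine ⟨WeakDual.toStrongDual ψ, by simpa using hψ, fun e => ?_⟩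
  exact ((WeakDual.eval_continuous e).tendsto ψ).comp
    (show Tendsto _ (U : Filter α) (𝓝 ψ) from hlim)

/-! ### Indicator functions of points in the bidual of `C(M)` -/

section Bump

variable (𝕜 : Type*) {M : Type*} [RCLike 𝕜] [MetricSpace M]

/-- The function `y ↦ max 0 (1 - n * dist y x)`, which peaks at `x` and, for `n > 0`, is supported in
the closed ball of radius `1 / n` about it. -/
noncomputable def coneFun (x : M) (n : ℕ) : C(M, 𝕜) where
  toFun y := ((max 0 (1 - n * dist y x) : ℝ) : 𝕜)

variable {𝕜}

theorem norm_coneFun_apply_le_one (x : M) (n : ℕ) (y : M) : ‖coneFun 𝕜 x n y‖ ≤ 1 := by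
  have h : 0 ≤ (n : ℝ) * dist y x := by positivity
  simp only [coneFun, ContinuousMap.coe_mk, RCLike.norm_ofReal]
  rw [abs_of_nonneg (le_max_left _ _)]
  exact max_le zero_le_one (by linarith)

theorem coneFun_self (x : M) (n : ℕ) : coneFun 𝕜 x n x = 1 := by
  simp [coneFun]

theorem coneFun_eq_zero {x y : M} {n : ℕ} (h : 1 ≤ n * dist y x) : coneFun 𝕜 x n y = 0 := by
  simp [coneFun, max_eq_left (sub_nonpos.2 h)]

variable [CompactSpace M]

theorem norm_coneFun_le_one (x : M) (n : ℕ) : ‖coneFun 𝕜 x n‖ ≤ 1 :=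
  (ContinuousMap.norm_le _ zero_le_one).2 (norm_coneFun_apply_le_one x n)

theorem tendsto_mul_coneFun_sub (x : M) (g : C(M, 𝕜)) :
    Tendsto (fun n => g * coneFun 𝕜 x n - g x • coneFun 𝕜 x n) atTop (𝓝 0) := by
  rw [Metric.tendsto_atTop]
  intro ε hε
  obtain ⟨δ, hδ, hg⟩ := Metric.continuousAt_iff.1 g.continuous.continuousAt (ε / 2) (half_pos hε)
  obtain ⟨N, hN⟩ := exists_nat_ge (1 / δ)
  refine ⟨N, fun n hn => ?_⟩
  rw [dist_zero_right]
  refine lt_of_le_of_lt ((ContinuousMap.norm_le _ (half_pos hε).le).2 fun y => ?_) (half_lt_self hε)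
  have hy : (g * coneFun 𝕜 x n - g x • coneFun 𝕜 x n) y = (g y - g x) * coneFun 𝕜 x n y := by
    simp [sub_mul]
  rw [hy]
  by_cases hd : dist y x < δ
  · rw [norm_mul]
    have h1 : ‖g y - g x‖ ≤ ε / 2 := by
      rw [← dist_eq_norm]
      exact (hg hd).le
    exact (mul_le_mul h1 (norm_coneFun_apply_le_one x n y) (norm_nonneg _)
      (half_pos hε).le).trans_eq (mul_one _)
  · have h2 : (1 : ℝ) ≤ n * dist y x := by
      have hn' : (N : ℝ) ≤ n := by exact_mod_cast hn
      calc (1 : ℝ) = 1 / δ * δ := by field_simp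
        _ ≤ n * dist y x := mul_le_mul (hN.trans hn') (not_lt.1 hd) hδ.le (by positivity)
    rw [coneFun_eq_zero h2, mul_zero, norm_zero]
    exact (half_pos hε).le

/-- A weak-* limit point in the bidual of the functions `coneFun 𝕜 x n` acts as the indicator
function of `x`. -/
theorem exists_isPointMean_eval (x : M) :
    ∃ κ : (C(M, 𝕜) →L[𝕜] 𝕜) →L[𝕜] 𝕜,
      IsPointMean (ContinuousLinearMap.mul 𝕜 C(M, 𝕜)) (ContinuousMap.evalCLM 𝕜 x) κ := by
  obtain ⟨κ, hκ, hlim⟩ := (hyperfilter ℕ).exists_tendsto_apply_of_norm_le (C := 1)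
    (φ := fun n => ContinuousLinearMap.apply 𝕜 𝕜 (coneFun 𝕜 x n)) (fun n => by
      refine ContinuousLinearMap.opNorm_le_bound _ zero_le_one fun η => ?_
      rw [ContinuousLinearMap.apply_apply, one_mul]
      exact (η.le_opNorm _).trans
        (mul_le_of_le_one_right (norm_nonneg _) (norm_coneFun_le_one x n)))
  simp only [ContinuousLinearMap.apply_apply] at hlim
  refine ⟨κ, fun η => ?_, fun r η => ?_, fun g η => ?_, ?_⟩
  · exact (κ.le_opNorm η).trans (mul_le_of_le_one_left (norm_nonneg _) hκ)
  · have h : (ContinuousLinearMap.mul 𝕜 𝕜 r).comp η = r • η := by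
      ext f
      simp
    rw [h, map_smul, smul_eq_mul]
  · have h0 := ((η.continuous.tendsto 0).comp (tendsto_mul_coneFun_sub x g)).mono_left
      (Nat.hyperfilter_le_atTop)
    have h1 := (hlim η).const_mul (g x)
    have h2 := h0.add h1
    refine tendsto_nhds_unique (hlim _) ?_
    simpa [Function.comp_def, mul_comm] using h2
  · refine tendsto_nhds_unique (hlim _) ?_
    simp [coneFun_self]

end Bump

/-! ### Families of functionals as operators into `ℓ^∞(M)` -/

section Bounded

variable {𝕜 M A : Type*} [RCLike 𝕜]

/-- The operator `a ↦ (x ↦ T x a)` into the bounded functions on `M` given by a uniformly bounded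
family of functionals. -/
noncomputable def lpInftyPi [NormedAddCommGroup A] [NormedSpace 𝕜 A] (T : M → (A →L[𝕜] 𝕜)) (C : ℝ)
    (hT : ∀ x, ‖T x‖ ≤ C) : A →L[𝕜] lp (fun _ : M => 𝕜) ∞ :=
  LinearMap.mkContinuous
    { toFun := fun a => ⟨fun x => T x a, memℓp_infty ⟨C * ‖a‖, by
        rintro _ ⟨x, rfl⟩
        exact (T x).le_of_opNorm_le (hT x) a⟩⟩
      map_add' := fun a b => by ext x; exact (T x).map_add a b
      map_smul' := fun c a => by ext x; exact (T x).map_smul c a } (max C 0) fun a => by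
    -- `C` may be negative if `M` is empty.
    refine lp.norm_le_of_forall_le (by positivity) fun x => ?_
    exact (T x).le_of_opNorm_le ((hT x).trans (le_max_left _ _)) a

end Bounded

section Embedding

variable {𝕜 M A : Type*} [RCLike 𝕜] [NormedAddCommGroup A] [NormedSpace 𝕜 A]

theorem norm_lpEvalCLM_comp_le (Φ : A →L[𝕜] lp (fun _ : M => 𝕜) ∞) (x : M) :
    ‖(lp.evalCLM 𝕜 (fun _ : M => 𝕜) ∞ x).comp Φ‖ ≤ ‖Φ‖ :=
  ContinuousLinearMap.opNorm_le_bound _ (norm_nonneg _) fun a =>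
    (lp.norm_apply_le_norm ENNReal.top_ne_zero (Φ a) x).trans (Φ.le_opNorm a)

variable [TopologicalSpace M] [CompactSpace M]

variable (𝕜 M) in
/-- The inclusion of the continuous functions into all bounded functions on `M`, realised as
`lp (fun _ : M => 𝕜) ∞`. -/
noncomputable def toLpInfty : C(M, 𝕜) →L[𝕜] lp (fun _ : M => 𝕜) ∞ :=
  lpInftyPi (fun x => ContinuousMap.evalCLM 𝕜 x) 1 fun x =>
    ContinuousLinearMap.opNorm_le_bound _ zero_le_one fun f => by
      rw [one_mul]
      exact f.norm_coe_le_norm x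

theorem norm_toLpInfty (f : C(M, 𝕜)) : ‖toLpInfty 𝕜 M f‖ = ‖f‖ := by
  refine le_antisymm (lp.norm_le_of_forall_le (norm_nonneg _) fun x => f.norm_coe_le_norm x) ?_
  exact (ContinuousMap.norm_le _ (norm_nonneg _)).2 fun x =>
    lp.norm_apply_le_norm ENNReal.top_ne_zero (toLpInfty 𝕜 M f) x

end Embedding

section Family

variable {𝕜 M : Type*} [RCLike 𝕜] [MetricSpace M] [CompactSpace M]

/-- The functionals of `exists_isPointMean_eval`, for all points of `M` together. -/
theorem exists_isPointMean_toLpInfty :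
    ∃ K : (C(M, 𝕜) →L[𝕜] lp (fun _ : M => 𝕜) ∞) →L[𝕜] lp (fun _ : M => 𝕜) ∞,
      IsPointMean (ContinuousLinearMap.mul 𝕜 C(M, 𝕜)) (toLpInfty 𝕜 M) K := by
  choose κ hκ using exists_isPointMean_eval (𝕜 := 𝕜) (M := M)
  have hbound : ∀ x, ‖(κ x).comp (ContinuousLinearMap.compL 𝕜 C(M, 𝕜) (lp (fun _ : M => 𝕜) ∞) 𝕜
      (lp.evalCLM 𝕜 (fun _ : M => 𝕜) ∞ x))‖ ≤ 1 := fun x =>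
    ContinuousLinearMap.opNorm_le_bound _ zero_le_one fun Ψ => by
      rw [one_mul]
      exact ((hκ x).norm_apply_le _).trans (norm_lpEvalCLM_comp_le Ψ x)
  refine ⟨lpInftyPi _ 1 hbound, fun Ψ => ?_, fun r Ψ => ?_, fun g Ψ => ?_, ?_⟩
  · exact lp.norm_le_of_forall_le (norm_nonneg _) fun x =>
      ((hκ x).norm_apply_le _).trans (norm_lpEvalCLM_comp_le Ψ x)
  · ext x
    exact (hκ x).map_mul_comp (r x) ((lp.evalCLM 𝕜 (fun _ : M => 𝕜) ∞ x).comp Ψ)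
  · ext x
    exact (hκ x).map_comp_mul g ((lp.evalCLM 𝕜 (fun _ : M => 𝕜) ∞ x).comp Ψ)
  · ext x
    exact (hκ x).map_self

/-- A multiplicative operator into `ℓ^∞(M)` near the inclusion takes values in `C(M, 𝕜)`: a
weak-* limit of its components at points tending to `x` is multiplicative and near the evaluation
at `x`, so uniqueness identifies it with the component at `x`. -/
theorem continuous_apply_of_map_mul {B : C(M, 𝕜) →L[𝕜] C(M, 𝕜) →L[𝕜] C(M, 𝕜)}
    {Φ : C(M, 𝕜) →L[𝕜] lp (fun _ : M => 𝕜) ∞} (hΦ : ∀ f g, Φ (B f g) = Φ f * Φ g)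
    (hsmall : ‖B - ContinuousLinearMap.mul 𝕜 C(M, 𝕜)‖ + ‖Φ - toLpInfty 𝕜 M‖ < 1 / 2)
    (f : C(M, 𝕜)) : Continuous fun x => Φ f x := by
  set φ : M → (C(M, 𝕜) →L[𝕜] 𝕜) := fun x => (lp.evalCLM 𝕜 (fun _ : M => 𝕜) ∞ x).comp Φ with hφ
  have hφ_mul : ∀ x g l, φ x (B g l) = φ x g * φ x l := fun x g l =>
    congrArg (fun F : lp (fun _ : M => 𝕜) ∞ => F x) (hΦ g l)
  have hφ_near : ∀ x, ‖φ x - ContinuousMap.evalCLM 𝕜 x‖ ≤ ‖Φ - toLpInfty 𝕜 M‖ := fun x =>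
    norm_lpEvalCLM_comp_le (Φ - toLpInfty 𝕜 M) x
  rw [continuous_iff_continuousAt]
  intro x
  rw [ContinuousAt, tendsto_iff_ultrafilter]
  intro U hU
  obtain ⟨ψ, -, hψ⟩ := U.exists_tendsto_apply_of_norm_le (φ := φ) (C := ‖Φ‖)
    (fun y => norm_lpEvalCLM_comp_le Φ y)
  have hψ_mul : ∀ g l, ψ (B g l) = ψ g * ψ l := fun g l =>
    tendsto_nhds_unique (hψ _) (by simpa only [hφ_mul] using (hψ g).mul (hψ l))
  have hψ_near : ‖ψ - ContinuousMap.evalCLM 𝕜 x‖ ≤ ‖Φ - toLpInfty 𝕜 M‖ := by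
    refine ContinuousLinearMap.opNorm_le_bound _ (norm_nonneg _) fun g => ?_
    have hlim : Tendsto (fun y => ‖φ y g - g y‖) U (𝓝 ‖ψ g - g x‖) :=
      ((hψ g).sub ((g.continuous.tendsto x).mono_left hU)).norm
    exact le_of_tendsto' hlim fun y =>
      (φ y - ContinuousMap.evalCLM 𝕜 y).le_of_opNorm_le (hφ_near y) g
  obtain ⟨κ, hκ⟩ := exists_isPointMean_eval (𝕜 := 𝕜) x
  have heq : ψ = φ x := hκ.eq_of_map_mul hψ_mul (hφ_mul x) (by
    linarith [hφ_near x, hψ_near, norm_nonneg (B - ContinuousLinearMap.mul 𝕜 C(M, 𝕜))])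
  have h := hψ f
  rw [heq] at h
  exact h

theorem exists_toLpInfty_comp_eq {Φ : C(M, 𝕜) →L[𝕜] lp (fun _ : M => 𝕜) ∞}
    (hΦ : ∀ f, Continuous fun x => Φ f x) :
    ∃ T : C(M, 𝕜) →L[𝕜] C(M, 𝕜), (toLpInfty 𝕜 M).comp T = Φ := by
  refine ⟨LinearMap.mkContinuous
    { toFun := fun f => ⟨fun x => Φ f x, hΦ f⟩
      map_add' := fun f g => by
        ext x
        exact congrArg (fun F : lp (fun _ : M => 𝕜) ∞ => F x) (Φ.map_add f g)
      map_smul' := fun c f => by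
        ext x
        exact congrArg (fun F : lp (fun _ : M => 𝕜) ∞ => F x) (Φ.map_smul c f) } ‖Φ‖ fun f => ?_,
    rfl⟩
  rw [ContinuousMap.norm_le _ (by positivity)]
  exact fun x => (lp.norm_apply_le_norm ENNReal.top_ne_zero (Φ f) x).trans (Φ.le_opNorm f)

end Family

/-! ### Regularity of a curve in a closed subspace -/

/-- A curve is `C^1` if its image under a linear isometry is: as the range is closed, it contains
the derivative of the image curve. -/
theorem LinearIsometry.contDiffOn_one_of_comp {E F : Type*} [NormedAddCommGroup E]
    [NormedSpace ℝ E] [CompleteSpace E] [NormedAddCommGroup F] [NormedSpace ℝ F] (j : E →ₗᵢ[ℝ] F)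
    {f : ℝ → E} {s : Set ℝ} (hs : IsOpen s) (hf : ContDiffOn ℝ 1 (fun t => j (f t)) s) :
    ContDiffOn ℝ 1 f s := by
  have hclosed : IsClosed (range j) := j.isometry.isClosedEmbedding.isClosed_range
  have hderiv : ∀ t ∈ s, HasDerivAt (fun t => j (f t)) (deriv (fun t => j (f t)) t) t := fun t ht =>
    ((hf.differentiableOn one_ne_zero).differentiableAt (hs.mem_nhds ht)).hasDerivAt
  have hmem : ∀ t ∈ s, deriv (fun t => j (f t)) t ∈ range j := by
    intro t ht
    refine hclosed.mem_of_tendsto (hasDerivAt_iff_tendsto_slope.1 (hderiv t ht))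
      (Eventually.of_forall fun y => ⟨slope f t y, ?_⟩)
    simp [slope_def_module]
  choose! g hg using hmem
  have hfg : ∀ t ∈ s, HasDerivAt f (g t) t := by
    intro t ht
    have h1 := hderiv t ht
    rw [← hg t ht, hasDerivAt_iff_isLittleO] at h1
    rw [hasDerivAt_iff_isLittleO]
    refine (h1.norm_left.congr_left fun y => ?_).of_norm_left
    rw [← j.norm_map (f y - f t - (y - t) • g t)]
    simp
  have hgc : ContinuousOn g s := by
    rw [j.isometry.isEmbedding.continuousOn_iff]
    exact (hf.continuousOn_deriv_of_isOpen hs le_rfl).congr fun t ht => hg t ht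
  rw [show (1 : ℕ∞ω) = 0 + 1 from (zero_add 1).symm, contDiffOn_succ_iff_deriv_of_isOpen hs]
  refine ⟨fun t ht => (hfg t ht).differentiableAt.differentiableWithinAt, by simp, ?_⟩
  rw [contDiffOn_zero]
  exact hgc.congr fun t ht => (hfg t ht).deriv

/-! ### Trivialising the deformation -/

section Tensor

variable (𝕜 M : Type*) [RCLike 𝕜] [TopologicalSpace M] [CompactSpace M]

/-- The elementary tensor `tensorFun` as a bounded bilinear map. -/
noncomputable def tensorL : C(M, 𝕜) →L[𝕜] C(M, 𝕜) →L[𝕜] C(M × M, 𝕜) :=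
  LinearMap.mkContinuous₂ (LinearMap.mk₂ 𝕜 tensorFun
    (fun f₁ f₂ g => by ext; simp [tensorFun, add_mul])
    (fun c f g => by ext; simp [tensorFun])
    (fun f g₁ g₂ => by ext; simp [tensorFun, mul_add])
    (fun c f g => by ext; simp [tensorFun])) 1 fun f g => by
  rw [one_mul, ContinuousMap.norm_le _ (by positivity)]
  rintro ⟨x, y⟩
  exact (norm_mul_le _ _).trans (mul_le_mul (f.norm_coe_le_norm x) (g.norm_coe_le_norm y)
    (norm_nonneg _) (norm_nonneg _))

end Tensor

section Deformation

variable {𝕜 M : Type*} [RCLike 𝕜] [MetricSpace M] [CompactSpace M]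

variable (𝕜 M) in
/-- Composition with the inclusion `toLpInfty`, as a real-linear isometry. -/
noncomputable def toLpInftyCompₗᵢ : (C(M, 𝕜) →L[𝕜] C(M, 𝕜)) →ₗᵢ[ℝ]
    (C(M, 𝕜) →L[𝕜] lp (fun _ : M => 𝕜) ∞) where
  toFun T := (toLpInfty 𝕜 M).comp T
  map_add' S T := ContinuousLinearMap.comp_add _ S T
  map_smul' c T := ((ContinuousLinearMap.compL 𝕜 C(M, 𝕜) C(M, 𝕜) (lp (fun _ : M => 𝕜) ∞)
    (toLpInfty 𝕜 M)).restrictScalars ℝ).map_smul c T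
  norm_map' T := LinearIsometry.norm_toContinuousLinearMap_comp
    ⟨(toLpInfty 𝕜 M).toLinearMap, norm_toLpInfty⟩ (g := T)

/-- The deformed characters, assembled into operators on `C(M, 𝕜)`: for small `t` the operator `T t`
is a homomorphism from the deformed product to the pointwise one. -/
theorem exists_contDiffAt_map_mul {m : ℝ → (C(M × M, 𝕜) →L[𝕜] C(M, 𝕜))}
    (hm0 : ∀ f g, m 0 (tensorFun f g) = f * g) (hm : ContDiffAt ℝ 1 m 0)
    (hassoc : ∀ᶠ t in 𝓝 0, ∀ f g l, m t (tensorFun (m t (tensorFun f g)) l) =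
      m t (tensorFun f (m t (tensorFun g l)))) :
    ∃ T : ℝ → (C(M, 𝕜) →L[𝕜] C(M, 𝕜)), T 0 = ContinuousLinearMap.id 𝕜 C(M, 𝕜) ∧
      ContDiffAt ℝ 1 T 0 ∧ ∀ᶠ t in 𝓝 0, ∀ f g, T t (m t (tensorFun f g)) = T t f * T t g := by
  obtain ⟨K, hK⟩ := exists_isPointMean_toLpInfty (𝕜 := 𝕜) (M := M)
  have hbase : productOfExtension (tensorL 𝕜 M) (m 0) = ContinuousLinearMap.mul 𝕜 C(M, 𝕜) := by
    ext1 f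
    ext1 g
    exact hm0 f g
  obtain ⟨Φ, hΦ0, hΦ, hev⟩ := hK.exists_contDiffAt_map_mul_extension (ε := 1 / 2) (by norm_num)
    (by norm_num) hbase
  have hcomp : ContDiffAt ℝ 1 (fun t => Φ (m t)) 0 :=
    ContDiffAt.comp (g := Φ) 0 (hΦ.restrict_scalars ℝ) hm
  have hlift : ∀ᶠ t in 𝓝 0, ∃ T : C(M, 𝕜) →L[𝕜] C(M, 𝕜), (toLpInfty 𝕜 M).comp T = Φ (m t) ∧
      ∀ f g, T (m t (tensorFun f g)) = T f * T g := by
    filter_upwards [hm.continuousAt.eventually hev, hassoc] with t ht hassoc_t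
    have hmul := ht.2 hassoc_t
    obtain ⟨T, hT⟩ := exists_toLpInfty_comp_eq
      (continuous_apply_of_map_mul (B := productOfExtension (tensorL 𝕜 M) (m t)) hmul ht.1)
    refine ⟨T, hT, fun f g => ?_⟩
    rw [← hT] at hmul
    ext x
    exact congrArg (fun F : lp (fun _ : M => 𝕜) ∞ => F x) (hmul f g)
  -- Away from a neighbourhood of `0` the values of `T` are arbitrary.
  choose! T hT using fun t (h : ∃ T : C(M, 𝕜) →L[𝕜] C(M, 𝕜), (toLpInfty 𝕜 M).comp T = Φ (m t) ∧
      ∀ f g, T (m t (tensorFun f g)) = T f * T g) => h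
  refine ⟨T, ?_, ?_, hlift.mono fun t ht => (hT t ht).2⟩
  · refine (toLpInftyCompₗᵢ 𝕜 M).injective ?_
    exact ((hT 0 hlift.self_of_nhds).1.trans hΦ0).trans
      (ContinuousLinearMap.comp_id _).symm
  · obtain ⟨ε, hε, hball⟩ := Metric.eventually_nhds_iff_ball.1
      (hlift.and (hcomp.eventually (by simp)))
    refine ContDiffOn.contDiffAt ?_ (Metric.ball_mem_nhds 0 hε)
    refine LinearIsometry.contDiffOn_one_of_comp
      (F := C(M, 𝕜) →L[𝕜] lp (fun _ : M => 𝕜) ∞) (toLpInftyCompₗᵢ 𝕜 M) Metric.isOpen_ball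
      fun t ht => ?_
    exact (hball t ht).2.contDiffWithinAt.congr_of_mem
      (fun y hy => (hT y (hball y hy).1).1) ht

end Deformation

theorem mainTheorem3 {𝕜 : Type*} [RCLike 𝕜] {M : Type*} [MetricSpace M] [CompactSpace M]
    (I : Set ℝ) (hI_open : IsOpen I) (hI_interval : I.OrdConnected) (hI_zero : (0 : ℝ) ∈ I)
    (mul : ℝ → C(M, 𝕜) →ₗ[𝕜] C(M, 𝕜) →ₗ[𝕜] C(M, 𝕜))
    (hmul : IsContinuousDeformation 1 I mul) :
    ∃ ε : ℝ, 0 < ε ∧ Ioo (-ε) ε ⊆ I ∧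
      ∃ h : ℝ → (C(M, 𝕜) ≃L[𝕜] C(M, 𝕜)),
        h 0 = ContinuousLinearEquiv.refl 𝕜 C(M, 𝕜) ∧
        (∀ t ∈ Ioo (-ε) ε, ∀ f g : C(M, 𝕜), h t (f * g) = mul t (h t f) (h t g)) ∧
        ContDiffOn ℝ 1 (fun t => (h t : C(M, 𝕜) →L[𝕜] C(M, 𝕜))) (Ioo (-ε) ε) := by
  obtain ⟨m, hm, hmdiff⟩ := hmul.exists_extension
  have hI : I ∈ 𝓝 (0 : ℝ) := hI_open.mem_nhds hI_zero
  have hassoc : ∀ᶠ t in 𝓝 0, ∀ f g l, m t (tensorFun (m t (tensorFun f g)) l) =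
      m t (tensorFun f (m t (tensorFun g l))) := by
    filter_upwards [hI] with t ht f g l
    simp only [hm t ht _ _, hmul.assoc t ht]
  obtain ⟨S, hS0, hSdiff, hSmul⟩ := exists_contDiffAt_map_mul
    (fun f g => (hm 0 hI_zero f g).trans (hmul.mul_zero_eq f g)) (hmdiff.contDiffAt hI) hassoc
  have hinv : ContDiffAt ℝ 1 (fun t => (S t).inverse) 0 := by
    refine ContDiffAt.comp (g := ContinuousLinearMap.inverse) 0 ?_ hSdiff
    rw [hS0]
    exact (contDiffAt_map_inverse (𝕜 := 𝕜)
      (ContinuousLinearEquiv.refl 𝕜 C(M, 𝕜))).restrict_scalars ℝ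
  have hunit : ∀ᶠ t in 𝓝 0, ∃ e : C(M, 𝕜) ≃L[𝕜] C(M, 𝕜), (e : C(M, 𝕜) →L[𝕜] C(M, 𝕜)) = S t := by
    refine hSdiff.continuousAt.eventually (p := fun A => ∃ e : C(M, 𝕜) ≃L[𝕜] C(M, 𝕜),
      (e : C(M, 𝕜) →L[𝕜] C(M, 𝕜)) = A) ?_
    rw [hS0]
    exact ContinuousLinearEquiv.nhds (ContinuousLinearEquiv.refl 𝕜 C(M, 𝕜))
  have hinv' := hinv.eventually (by simp)
  obtain ⟨ε, hε, hball⟩ := Metric.eventually_nhds_iff_ball.1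
    ((eventually_mem_set.2 hI).and (hSmul.and (hunit.and hinv')))
  rw [Real.ball_eq_Ioo, zero_sub, zero_add] at hball
  -- `e t` is an equivalence with underlying map `S t`, for every `t` for which there is one.
  choose! e he using fun t (h : ∃ e : C(M, 𝕜) ≃L[𝕜] C(M, 𝕜), (e : C(M, 𝕜) →L[𝕜] C(M, 𝕜)) = S t) => h
  refine ⟨ε, hε, fun t ht => (hball t ht).1, fun t => (e t).symm, ?_, fun t ht f g => ?_, ?_⟩
  · have h0 := (he 0 hunit.self_of_nhds).trans hS0
    refine ContinuousLinearEquiv.ext (funext fun f => ?_)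
    exact (e 0).symm_apply_eq.2 (congrArg (fun A : C(M, 𝕜) →L[𝕜] C(M, 𝕜) => A f) h0).symm
  · obtain ⟨htI, htmul, htunit, -⟩ := hball t ht
    have hS : ∀ f, e t f = S t f := fun f =>
      congrArg (fun A : C(M, 𝕜) →L[𝕜] C(M, 𝕜) => A f) (he t htunit)
    rw [(e t).symm_apply_eq, ← hm t htI, hS, htmul, ← hS, ← hS, (e t).apply_symm_apply,
      (e t).apply_symm_apply]
  · intro t ht
    refine (hball t ht).2.2.2.contDiffWithinAt.congr_of_mem (fun y hy => ?_) ht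
    rw [← he y (hball y hy).2.2.1, ContinuousLinearMap.inverse_equiv]
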